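/- **Lemma (Extraction Lemma).** Let $x=\{x_1,\dots,x_n\}$ and $\mathcal M=\mathbb Z[x]^m$ with canonical basis $e_1,\dots,e_m$. Let $\mathcal N=Q\cap J$ be submodules of $\mathcal M$ such that $\mathcal N$ is pseudo-primary (i.e. $\sqrt{\operatorname{Ann}(\mathcal M/\mathcal N)}$ is prime), $Q$ is a $P$-primary submodule of $\mathcal M$ (i.e. $Q\neq\mathcal M$; if $rf\in Q$ with $r\in\mathbb Z[x]$, $f\in\mathcal M$, then $f\in Q$ or $r^k\mathcal M\subseteq Q$ for some $k$; and $\sqrt{\operatorname{Ann}(\mathcal M/Q)}=P$), and $\operatorname{ht}\operatorname{Ann}(\mathcal M/Q)<\operatorname{ht}\operatorname{Ann}(\mathcal M/J)$ (where the unit ideal has height $\infty$). Let $P\cap\mathbb Z=\langle p\rangle$, $p\ge 0$, and let $\mathbb F_p$ be the prime field of characteristic $p$ ($\mathbb F_0=\mathbb Q$). Let $u\subseteq x$ be a maximal independent set for $P$, i.e. a subset of maximal cardinality with $P\,\mathbb F_p[x]\cap\mathbb F_p[u]=\langle 0\rangle$. Put $q=1$ if $p=0$ and $q=p$ if $p>0$,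 and let $A=\mathbb Z[u]_{\langle p\rangle}$ be the localization of $\mathbb Z[u]$ at the prime ideal $\langle p\rangle$. A module ordering is a total ordering $>$ of the monomials $x^\alpha e_i$ which is invariant under multiplication by monomials of $\mathbb Z[x]$ and satisfies $x^\alpha e_i>x^\beta e_i$ whenever $x^\alpha>x^\beta$ for a given monomial (well-)ordering of $\mathbb Z[x]$. It is called a block ordering with $(x\smallsetminus u)e_i\gg u\,e_j$ if monomials are compared first by their parts in the variables $x\smallsetminus u$ together with the component, i.e. for monomials $v,v'$ in $x\smallsetminus u$ and $w,w'$ in $u$, $v e_i>v'e_j$ implies $vw\,e_i>v'w'e_j$. Its restriction to the monomials in $x\smallsetminus u$ is the induced ordering on $A[x\smallsetminus u]^m$. A term $a\,x^\alpha e_i$ divides $b\,x^\beta e_j$ if $i=j$, $a\mid b$ and $x^\alpha\mid x^\beta$; a finite subset $G$ of a submodule is a strong Gröbner basis of it if the leading term of each nonzero element of the submodule is divisible by the leading term of some nonzero element of $G$. Then: 1. $\mathcal N A[x\smallsetminus u]\cap\mathcal M=Q$. 2. If $G$ is a strong Gröbner basis of $\mathcal N$ with respect to a block ordering with $(x\smallsetminus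 u)e_i\gg u\,e_j$, then $G$ is also a strong Gröbner basis of $\mathcal N A[x\smallsetminus u]$ with respect to the induced ordering. 3. Let $G$ be as in 2, let $g_1,\dots,g_k$ be its nonzero elements, let the leading coefficient of $g_i$ as an element of $A[x\smallsetminus u]^m$ (for the induced ordering) be $q^{\nu_i}a_i$ with $\nu_i\ge 0$ and $a_i\in\mathbb Z[u]\smallsetminus\langle p\rangle$, and let $h=\operatorname{lcm}(a_1,\dots,a_k)$ in $\mathbb Z[u]$. Then $\mathcal N A[x\smallsetminus u]\cap\mathcal M=\mathcal N:h^\infty=\{f\in\mathcal M : h^k f\in\mathcal N\text{ for some }k\}$. -/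

import Mathlib

open MvPolynomial

namespace Extraction

section GroebnerBases

/-- Monomials `x^α e_i` of the free module `R[x]^ι`, encoded as pairs `(α, i)`. -/
abbrev Mon (σ ι : Type*) := (σ →₀ ℕ) × ι

/-- `r s t` means `s < t`.  The relation `r` is a module ordering on the monomials of `R[x]^ι`
which includes the monomial (well-)ordering `mo` of the polynomial ring. -/
structure IsModuleOrder {σ ι : Type*} (mo : MonomialOrder σ) (r : Mon σ ι → Mon σ ι → Prop) :
    Prop where
  irrefl : ∀ s, ¬ r s s
  trans : ∀ s t w, r s t → r t w → r s w
  total : ∀ s t, r s t ∨ s = t ∨ r t s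
  shift : ∀ (α β γ : σ →₀ ℕ) (i j : ι), r (α, i) (β, j) → r (α + γ, i) (β + γ, j)
  compat : ∀ (α β : σ →₀ ℕ) (i : ι), mo.toSyn α < mo.toSyn β → r (α, i) (β, i)

/-- The leading term of the vector `f` is `c x^α e_i`, where `s = (α, i)`. -/
def IsLeadingTerm {σ ι R : Type*} [CommSemiring R] (r : Mon σ ι → Mon σ ι → Prop)
    (f : ι → MvPolynomial σ R) (s : Mon σ ι) (c : R) : Prop :=
  c ≠ 0 ∧ coeff s.1 (f s.2) = c ∧ ∀ t : Mon σ ι, coeff t.1 (f t.2) ≠ 0 → t = s ∨ r t s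

/-- The term `c x^α e_i` divides the term `d x^β e_j`. -/
def TermDvd {σ ι R : Type*} [CommSemiring R] (s : Mon σ ι) (c : R) (t : Mon σ ι) (d : R) : Prop :=
  s.2 = t.2 ∧ c ∣ d ∧ s.1 ≤ t.1

/-- Strong Gröbner basis: a finite subset of `N` such that the leading term of every nonzero
element of `N` is divisible by the leading term of some element of the subset. -/
def IsStrongGroebnerBasis {σ ι R : Type*} [CommRing R] (r : Mon σ ι → Mon σ ι → Prop)
    (N : Submodule (MvPolynomial σ R) (ι → MvPolynomial σ R))
    (G : Set (ι → MvPolynomial σ R)) : Prop :=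
  G.Finite ∧ G ⊆ N ∧ ∀ f ∈ N, f ≠ 0 →
    ∃ g ∈ G, ∃ s c t d, IsLeadingTerm r g s c ∧ IsLeadingTerm r f t d ∧ TermDvd s c t d

/-- The ordering induced on the module monomials in the variables outside `u`. -/
def inducedOrder {σ ι : Type*} (u : Finset σ) (r : Mon σ ι → Mon σ ι → Prop) :
    Mon {i // i ∉ u} ι → Mon {i // i ∉ u} ι → Prop :=
  fun s t => r (s.1.mapDomain Subtype.val, s.2) (t.1.mapDomain Subtype.val, t.2)

/-- The module monomial `(x ∖ u)^α e_i` obtained from `x^α e_i` by deleting the variables in `u`. -/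
noncomputable def dropVars {σ ι : Type*} [DecidableEq σ] (u : Finset σ) (s : Mon σ ι) : Mon σ ι :=
  (s.1.filter (· ∉ u), s.2)

/-- Block ordering with `(x ∖ u) e_i ≫ u e_j`: monomials are compared first by their
parts `(x ∖ u)^α e_i`, so that the variables in `u` matter only when these parts agree. -/
def IsBlockOrder {σ ι : Type*} [DecidableEq σ] (u : Finset σ) (r : Mon σ ι → Mon σ ι → Prop) :
    Prop :=
  ∀ s t : Mon σ ι, r (dropVars u s) (dropVars u t) → r s t

end GroebnerBases

section Submodules

variable {R M : Type*} [CommRing R] [AddCommGroup M] [Module R M]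

/-- `N` is pseudo-primary in `M`: the radical of `Ann (M / N)` is a prime ideal. -/
def IsPseudoPrimary (N : Submodule R M) : Prop :=
  (Module.annihilator R (M ⧸ N)).radical.IsPrime

/-- The saturation `N : h^∞`. -/
def saturation (N : Submodule R M) (h : R) : Submodule R M where
  carrier := {f | ∃ k : ℕ, h ^ k • f ∈ N}
  zero_mem' := ⟨0, by simp⟩
  add_mem' := by
    rintro a b ⟨k, hk⟩ ⟨l, hl⟩
    refine ⟨k + l, ?_⟩
    rw [smul_add]
    refine N.add_mem ?_ ?_
    · rw [add_comm, pow_add, mul_smul]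
      exact N.smul_mem _ hk
    · rw [pow_add, mul_smul]
      exact N.smul_mem _ hl
  smul_mem' := by
    rintro c a ⟨k, hk⟩
    refine ⟨k, ?_⟩
    rw [smul_comm]
    exact N.smul_mem _ hk

/-- `h` is a least common multiple of the elements of `S`. -/
def IsLcm (S : Set R) (h : R) : Prop :=
  (∀ a ∈ S, a ∣ h) ∧ ∀ d, (∀ a ∈ S, a ∣ d) → h ∣ d

end Submodules

section Localization

variable {σ : Type*}

/-- The ideal `P ∩ ℤ` of `ℤ`. -/
noncomputable abbrev intPart (P : Ideal (MvPolynomial σ ℤ)) : Ideal ℤ := P.comap C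

/-- The prime field `𝔽_p` (which is `ℚ` if `p = 0`), where `P ∩ ℤ = ⟨p⟩`, as the residue field
of the prime `P ∩ ℤ` of `ℤ`. -/
abbrev PrimeField (P : Ideal (MvPolynomial σ ℤ)) [P.IsPrime] : Type := (intPart P).ResidueField

/-- The set `u` of variables is independent with respect to `P`: `P 𝔽_p[x] ∩ 𝔽_p[u] = 0`. -/
def IsIndependent (P : Ideal (MvPolynomial σ ℤ)) [P.IsPrime] (u : Finset σ) : Prop :=
  ∀ f ∈ P.map (MvPolynomial.map (Int.castRingHom (PrimeField P))),
    f ∈ supported (PrimeField P) (u : Set σ) → f = 0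

/-- Independent sets of maximal cardinality. -/
def IsMaxIndependent (P : Ideal (MvPolynomial σ ℤ)) [P.IsPrime] (u : Finset σ) : Prop :=
  IsIndependent P u ∧ ∀ v : Finset σ, IsIndependent P v → v.card ≤ u.card

/-- The prime ideal `⟨p⟩` of `ℤ[u]`, where `P ∩ ℤ = ⟨p⟩`. -/
noncomputable abbrev pIdeal (P : Ideal (MvPolynomial σ ℤ)) (u : Finset σ) :
    Ideal (MvPolynomial {i // i ∈ u} ℤ) := (intPart P).map C

instance pIdeal_isPrime (P : Ideal (MvPolynomial σ ℤ)) [P.IsPrime] (u : Finset σ) :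
    (pIdeal P u).IsPrime := by
  rw [← Ideal.Quotient.isDomain_iff_prime]
  exact (quotientEquivQuotientMvPolynomial (σ := {i // i ∈ u})
    (intPart P)).toRingEquiv.toMulEquiv.isDomain_iff.mp inferInstance

/-- The ring `A = ℤ[u]_⟨p⟩`. -/
abbrev A (P : Ideal (MvPolynomial σ ℤ)) [P.IsPrime] (u : Finset σ) : Type _ :=
  Localization.AtPrime (pIdeal P u)

/-- The ring `A[x ∖ u]`. -/
abbrev Ax (P : Ideal (MvPolynomial σ ℤ)) [P.IsPrime] (u : Finset σ) : Type _ :=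
  MvPolynomial {i // i ∉ u} (A P u)

variable [DecidableEq σ]

/-- The canonical ring homomorphism `ℤ[x] → A[x ∖ u]`. -/
noncomputable def toAx (P : Ideal (MvPolynomial σ ℤ)) [P.IsPrime] (u : Finset σ) :
    MvPolynomial σ ℤ →+* Ax P u :=
  eval₂Hom (Int.castRingHom (Ax P u)) fun i =>
    if hi : i ∈ u then C (algebraMap (MvPolynomial {i // i ∈ u} ℤ) (A P u) (X ⟨i, hi⟩))
    else X ⟨i, hi⟩

/-- The canonical map `ℤ[x]^ι → A[x ∖ u]^ι`, applied to each coordinate. -/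
noncomputable def toAxVec (P : Ideal (MvPolynomial σ ℤ)) [P.IsPrime] (u : Finset σ) (ι : Type*) :
    (ι → MvPolynomial σ ℤ) →ₛₗ[toAx P u] (ι → Ax P u) where
  toFun f := fun i => toAx P u (f i)
  map_add' f g := by ext1 i; simp
  map_smul' c f := by ext1 i; simp

/-- The extension `N A[x ∖ u]`, a submodule of `A[x ∖ u]^ι`. -/
noncomputable def extend (P : Ideal (MvPolynomial σ ℤ)) [P.IsPrime] (u : Finset σ) {ι : Type*}
    (N : Submodule (MvPolynomial σ ℤ) (ι → MvPolynomial σ ℤ)) :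
    Submodule (Ax P u) (ι → Ax P u) :=
  Submodule.span (Ax P u) (toAxVec P u ι '' N)

/-- The contraction `N A[x ∖ u] ∩ ℤ[x]^ι`. -/
noncomputable def extendContract (P : Ideal (MvPolynomial σ ℤ)) [P.IsPrime] (u : Finset σ)
    {ι : Type*} (N : Submodule (MvPolynomial σ ℤ) (ι → MvPolynomial σ ℤ)) :
    Submodule (MvPolynomial σ ℤ) (ι → MvPolynomial σ ℤ) :=
  (extend P u N).comap (toAxVec P u ι)

end Localization

end Extraction

open Extraction

/-! Clearing denominators, `f` lies in N A[x∖u] ∩ M exactly when s f ∈ N for some s ∈ ℤ[u] ∖ ⟨p⟩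
(`mem_extendContract_iff`).

Contraction is Q: independence of u means P ∩ ℤ[u] = ⟨p⟩, so such an s is outside P, and s f ∈ Q
forces f ∈ Q because Q is primary. Conversely, Ann(M/Q)·Ann(M/J) ⊆ √Ann(M/N), which is prime, and
the heights exclude Ann(M/J) ⊆ P; hence P = √Ann(M/N) ⊆ √Ann(M/J). By maximality of u, ℤ[x]/P is
algebraic over ℤ[u]/⟨p⟩, so √Ann(M/J), being strictly larger than P, contains some c ∈ ℤ[u] ∖ ⟨p⟩. A
power of c carries Q into Q ∩ J = N.

Gröbner basis over A: a block ordering makes leading monomials over ℤ and over A compatible; the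
difficulty is with coefficients. If f ∈ N has leading coefficient p^k a over A with a ∉ ⟨p⟩, its
leading integer may be divisible by more than p^k. Since a power of p kills M/N, f can be replaced
by an element of N with leading coefficient p^k a₀^K, where a₀ is the part of a whose coefficients
are prime to p (`exists_mem_isLeadingTerm_of_isLeadingTerm_toAxVec`). A basis element whose leading
term divides that of the new element over ℤ has at most p^k in its leading coefficient over A, which
is all that matters in A.

Saturation: each a_i divides h, so h f can be reduced by G without denominators. As the ordering is
well-founded, finitely many reductions bring h^k f into N (`exists_pow_smul_mem`). The converse
holds because h ∉ ⟨p⟩. -/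

namespace Extraction

/-! ### Polynomials in x as polynomials in x∖u over ℤ[u] -/

section SplitVars

variable {σ R : Type*}

theorem mapDomain_val_apply_of_not {q : σ → Prop} (β : {i // q i} →₀ ℕ) {i : σ} (hi : ¬ q i) :
    β.mapDomain Subtype.val i = 0 :=
  Finsupp.mapDomain_of_notMem_range _ _ (by rintro ⟨⟨j, hj⟩, rfl⟩; exact hi hj)

theorem mapDomain_val_apply {q : σ → Prop} (β : {i // q i} →₀ ℕ) {i : σ} (hi : q i) :
    β.mapDomain Subtype.val i = β ⟨i, hi⟩ :=
  Finsupp.mapDomain_apply Subtype.val_injective β ⟨i, hi⟩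

variable [CommRing R] [DecidableEq σ]

/-- The ring isomorphism `R[x] → R[u][x ∖ u]`, as a ring homomorphism. -/
noncomputable def splitVars (u : Finset σ) :
    MvPolynomial σ R →+* MvPolynomial {i // i ∉ u} (MvPolynomial {i // i ∈ u} R) :=
  eval₂Hom (C.comp C) fun i => if hi : i ∈ u then C (X ⟨i, hi⟩) else X ⟨i, hi⟩

theorem splitVars_monomial (u : Finset σ) (δ : σ →₀ ℕ) (a : R) :
    splitVars u (monomial δ a) =
      monomial (δ.subtypeDomain (· ∉ u)) (monomial (δ.subtypeDomain (· ∈ u)) a) := by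
  have key : splitVars u (monomial δ (1 : R)) =
      monomial (δ.subtypeDomain (· ∉ u)) (monomial (δ.subtypeDomain (· ∈ u)) 1) := by
    induction δ using Finsupp.induction_linear with
    | zero => simp [Finsupp.subtypeDomain_zero]
    | add f g hf hg =>
      rw [show (monomial (f + g) (1 : R)) = monomial f 1 * monomial g 1 by
        rw [monomial_mul, one_mul], map_mul, hf, hg, monomial_mul, monomial_mul,
        Finsupp.subtypeDomain_add, Finsupp.subtypeDomain_add, one_mul]
    | single i k =>
      rw [← X_pow_eq_monomial, map_pow, splitVars, eval₂Hom_X']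
      split_ifs with hi
      · have h1 : (Finsupp.single i k).subtypeDomain (· ∉ u) = 0 := by
          ext ⟨j, hj⟩
          simp only [Finsupp.subtypeDomain_apply, Finsupp.coe_zero, Pi.zero_apply]
          exact Finsupp.single_eq_of_ne (by rintro rfl; exact hj hi)
        have h2 : (Finsupp.single i k).subtypeDomain (· ∈ u) = Finsupp.single ⟨i, hi⟩ k := by
          ext ⟨j, hj⟩
          simp [Finsupp.single_apply]
        rw [h1, h2, ← map_pow, X_pow_eq_monomial, C_apply]
      · have h1 : (Finsupp.single i k).subtypeDomain (· ∈ u) = 0 := by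
          ext ⟨j, hj⟩
          simp only [Finsupp.subtypeDomain_apply, Finsupp.coe_zero, Pi.zero_apply]
          exact Finsupp.single_eq_of_ne (by rintro rfl; exact hi hj)
        have h2 : (Finsupp.single i k).subtypeDomain (· ∉ u) = Finsupp.single ⟨i, hi⟩ k := by
          ext ⟨j, hj⟩
          simp [Finsupp.single_apply]
        rw [h1, h2, X_pow_eq_monomial, monomial_zero', C_1]
  have ha : splitVars u (C a) = C (C a) := by simp [splitVars]
  rw [show monomial δ a = C a * monomial δ 1 by rw [C_mul_monomial, mul_one], map_mul, key, ha,
    C_mul_monomial, C_mul_monomial, mul_one]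

/-- The exponent `β + γ`, where `β` is an exponent outside `u` and `γ` is an exponent in `u`. -/
noncomputable def joinExp {u : Finset σ} (β : {i // i ∉ u} →₀ ℕ) (γ : {i // i ∈ u} →₀ ℕ) :
    σ →₀ ℕ :=
  β.mapDomain Subtype.val + γ.mapDomain Subtype.val

theorem joinExp_apply {u : Finset σ} (β : {i // i ∉ u} →₀ ℕ) (γ : {i // i ∈ u} →₀ ℕ) (i : σ) :
    joinExp β γ i = if hi : i ∈ u then γ ⟨i, hi⟩ else β ⟨i, hi⟩ := by
  rw [joinExp, Finsupp.add_apply]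
  split_ifs with hi
  · rw [mapDomain_val_apply_of_not (q := (· ∉ u)) β (by simpa using hi),
      mapDomain_val_apply (q := (· ∈ u)) γ hi, zero_add]
  · rw [mapDomain_val_apply_of_not (q := (· ∈ u)) γ hi,
      mapDomain_val_apply (q := (· ∉ u)) β hi, add_zero]

@[simp]
theorem joinExp_outer {u : Finset σ} (β : {i // i ∉ u} →₀ ℕ) (γ : {i // i ∈ u} →₀ ℕ) :
    (joinExp β γ).subtypeDomain (· ∉ u) = β := by
  ext ⟨i, hi⟩
  simp only [Finsupp.subtypeDomain_apply, joinExp_apply, dif_neg hi]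

@[simp]
theorem joinExp_inner {u : Finset σ} (β : {i // i ∉ u} →₀ ℕ) (γ : {i // i ∈ u} →₀ ℕ) :
    (joinExp β γ).subtypeDomain (· ∈ u) = γ := by
  ext ⟨i, hi⟩
  simp only [Finsupp.subtypeDomain_apply, joinExp_apply, dif_pos hi]

theorem joinExp_subtypeDomain (u : Finset σ) (δ : σ →₀ ℕ) :
    joinExp (δ.subtypeDomain (· ∉ u)) (δ.subtypeDomain (· ∈ u)) = δ := by
  ext i
  rw [joinExp_apply]
  split_ifs <;> rfl

/-- Injectivity of `splitVars` and the later comparison of leading terms over ℤ and over A rest on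
this formula. -/
theorem coeff_coeff_splitVars {u : Finset σ} (f : MvPolynomial σ R) (β : {i // i ∉ u} →₀ ℕ)
    (γ : {i // i ∈ u} →₀ ℕ) :
    coeff γ (coeff β (splitVars u f)) = coeff (joinExp β γ) f := by
  induction f using MvPolynomial.monomial_add_induction_on with
  | C a =>
    rw [C_apply, splitVars_monomial, coeff_monomial, coeff_monomial]
    by_cases h : joinExp β γ = 0
    · have h1 := joinExp_outer β γ
      have h2 := joinExp_inner β γ
      rw [h] at h1 h2
      rw [if_pos h1, coeff_monomial, if_pos h2, if_pos h.symm]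
    · rw [if_neg (Ne.symm h)]
      split_ifs with h1
      · rw [coeff_monomial, if_neg]
        intro h2
        apply h
        rw [← h1, ← h2, joinExp_subtypeDomain]
      · simp
  | monomial_add δ a f _ _ ih =>
    rw [map_add, coeff_add, coeff_add, coeff_add, ih, splitVars_monomial, coeff_monomial,
      coeff_monomial]
    congr 1
    by_cases h : δ = joinExp β γ
    · subst h
      simp
    · rw [if_neg h]
      split_ifs with h1
      · rw [coeff_monomial, if_neg]
        intro h2
        apply h
        rw [← h1, ← h2, joinExp_subtypeDomain]
      · simp

theorem splitVars_injective (u : Finset σ) :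
    Function.Injective (splitVars u : MvPolynomial σ R →+* _) := by
  intro f g h
  ext δ
  rw [← joinExp_subtypeDomain u δ, ← coeff_coeff_splitVars, ← coeff_coeff_splitVars, h]

theorem splitVars_rename_inner (u : Finset σ) (c : MvPolynomial {i // i ∈ u} R) :
    splitVars u (rename Subtype.val c) = C c := by
  induction c using MvPolynomial.induction_on with
  | C a => simp [splitVars]
  | add f g hf hg => simp [hf, hg]
  | mul_X f i hf =>
    rw [map_mul, map_mul, hf, map_mul]
    simp [splitVars]

theorem splitVars_monomial_outer (u : Finset σ) (β : {i // i ∉ u} →₀ ℕ) :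
    splitVars u (monomial (β.mapDomain Subtype.val) (1 : R)) = monomial β 1 := by
  have h : β.mapDomain Subtype.val = joinExp β 0 := by simp [joinExp]
  rw [splitVars_monomial, h, joinExp_outer, joinExp_inner]
  rfl

theorem splitVars_surjective (u : Finset σ) :
    Function.Surjective (splitVars u : MvPolynomial σ R →+* _) := by
  intro f
  induction f using MvPolynomial.induction_on with
  | C a => exact ⟨rename Subtype.val a, splitVars_rename_inner u a⟩
  | add f g hf hg =>
    obtain ⟨f', rfl⟩ := hf
    obtain ⟨g', rfl⟩ := hg
    exact ⟨f' + g', map_add _ _ _⟩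
  | mul_X f i hf =>
    obtain ⟨f', rfl⟩ := hf
    refine ⟨f' * X i.1, ?_⟩
    rw [map_mul]
    simp [splitVars, i.2]

end SplitVars

/-! ### Clearing denominators in extended submodules -/

section Fractions

/-- Elements of the extension of a submodule along a localization have numerators in it. -/
theorem exists_smul_eq_of_mem_span_image {R R' M M' : Type*} [CommRing R] [CommRing R']
    [AddCommGroup M] [AddCommGroup M'] [Module R M] [Module R' M'] {φ : R →+* R'}
    (S : Submonoid R) (hS : ∀ y : R', ∃ s ∈ S, ∃ x, φ s * y = φ x) (T : M →ₛₗ[φ] M')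
    (N : Submodule R M) {y : M'} (hy : y ∈ Submodule.span R' (T '' N)) :
    ∃ s ∈ S, ∃ g ∈ N, φ s • y = T g := by
  induction hy using Submodule.span_induction with
  | mem y hy =>
    obtain ⟨g, hg, rfl⟩ := hy
    exact ⟨1, S.one_mem, g, hg, by simp⟩
  | zero => exact ⟨1, S.one_mem, 0, N.zero_mem, by simp⟩
  | add y z _ _ hy hz =>
    obtain ⟨s, hs, g, hg, e⟩ := hy
    obtain ⟨t, ht, k, hk, e'⟩ := hz
    refine ⟨s * t, S.mul_mem hs ht, t • g + s • k,
      N.add_mem (N.smul_mem _ hg) (N.smul_mem _ hk), ?_⟩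
    rw [map_add, map_smulₛₗ, map_smulₛₗ, ← e, ← e', smul_add, smul_smul, smul_smul, ← map_mul,
      ← map_mul, mul_comm t s]
  | smul a y _ hy =>
    obtain ⟨s, hs, g, hg, e⟩ := hy
    obtain ⟨t, ht, x, hx⟩ := hS a
    refine ⟨t * s, S.mul_mem ht hs, x • g, N.smul_mem _ hg, ?_⟩
    rw [map_smulₛₗ, ← e, ← hx, smul_smul, smul_smul, map_mul]
    congr 1
    ring

end Fractions

/-! ### The ring A[x∖u] and contraction from it -/

section ToAx

variable {σ : Type*} (P : Ideal (MvPolynomial σ ℤ)) [P.IsPrime] (u : Finset σ)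

theorem algebraMap_A_injective :
    Function.Injective (algebraMap (MvPolynomial {i // i ∈ u} ℤ) (A P u)) :=
  IsLocalization.injective _ (Ideal.primeCompl_le_nonZeroDivisors (pIdeal P u))

theorem isUnit_algebraMap_A {s : MvPolynomial {i // i ∈ u} ℤ} (hs : s ∉ pIdeal P u) :
    IsUnit (algebraMap _ (A P u) s) :=
  IsLocalization.map_units (A P u) (⟨s, hs⟩ : (pIdeal P u).primeCompl)

variable [DecidableEq σ]

theorem toAx_eq (f : MvPolynomial σ ℤ) :
    toAx P u f = MvPolynomial.map (algebraMap (MvPolynomial {i // i ∈ u} ℤ) (A P u))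
      (splitVars u f) := by
  have : toAx P u = (MvPolynomial.map (algebraMap (MvPolynomial {i // i ∈ u} ℤ) (A P u))).comp
      (splitVars u) := by
    apply MvPolynomial.ringHom_ext
    · intro a
      simp
    · intro i
      simp only [toAx, coe_eval₂Hom, eval₂_X, RingHom.comp_apply, splitVars]
      split_ifs <;> simp
  rw [this]
  rfl

theorem coeff_toAx (f : MvPolynomial σ ℤ) (β : {i // i ∉ u} →₀ ℕ) :
    coeff β (toAx P u f) = algebraMap _ (A P u) (coeff β (splitVars u f)) := by
  rw [toAx_eq, coeff_map]

theorem toAx_injective : Function.Injective (toAx P u) := by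
  intro f g h
  rw [toAx_eq, toAx_eq] at h
  exact splitVars_injective u (map_injective _ (algebraMap_A_injective P u) h)

theorem toAx_rename (c : MvPolynomial {i // i ∈ u} ℤ) :
    toAx P u (rename Subtype.val c) = C (algebraMap _ (A P u) c) := by
  rw [toAx_eq, splitVars_rename_inner, map_C]

theorem toAx_monomial (β : {i // i ∉ u} →₀ ℕ) :
    toAx P u (monomial (β.mapDomain Subtype.val) 1) = monomial β 1 := by
  rw [toAx_eq, splitVars_monomial_outer, map_monomial, map_one]

theorem toAxVec_apply {ι : Type*} (f : ι → MvPolynomial σ ℤ) (i : ι) :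
    toAxVec P u ι f i = toAx P u (f i) := rfl

theorem toAxVec_injective (ι : Type*) : Function.Injective (toAxVec P u ι) := by
  intro f g h
  ext1 i
  exact toAx_injective P u (congrFun h i)

/-- The multiplicative set of `ℤ[x]` of the polynomials in `ℤ[u]` outside of `⟨p⟩`. -/
noncomputable def denominators : Submonoid (MvPolynomial σ ℤ) :=
  (pIdeal P u).primeCompl.map (rename (R := ℤ) (Subtype.val : {i // i ∈ u} → σ))

theorem exists_toAx_mul_eq (y : Ax P u) :
    ∃ s ∈ denominators P u, ∃ x, toAx P u s * y = toAx P u x := by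
  -- With this algebra structure, A[x∖u] is the localization of ℤ[u][x∖u] at the constants outside
  -- ⟨p⟩.
  let := algebraMvPolynomial (σ := {i // i ∉ u}) (R := MvPolynomial {i // i ∈ u} ℤ) (S := A P u)
  obtain ⟨⟨x, ⟨_, s, hs, rfl⟩⟩, h⟩ :=
    IsLocalization.surj ((pIdeal P u).primeCompl.map (C (σ := {i // i ∉ u}))) y
  obtain ⟨x', rfl⟩ := splitVars_surjective u x
  refine ⟨rename Subtype.val s, ⟨s, hs, rfl⟩, x', ?_⟩
  rw [toAx_rename, toAx_eq, mul_comm]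
  rw [algebraMap_def, map_C] at h
  exact h

theorem exists_smul_eq_of_mem_extend {ι : Type*}
    {N : Submodule (MvPolynomial σ ℤ) (ι → MvPolynomial σ ℤ)} {y : ι → Ax P u}
    (hy : y ∈ extend P u N) :
    ∃ s ∉ pIdeal P u, ∃ g ∈ N, (C (algebraMap _ (A P u) s) : Ax P u) • y = toAxVec P u ι g := by
  obtain ⟨x, hx, g, hg, e⟩ := exists_smul_eq_of_mem_span_image (R' := Ax P u)
    (M' := ι → Ax P u) (φ := toAx P u) (M := ι → MvPolynomial σ ℤ) (denominators P u)
    (exists_toAx_mul_eq P u) (toAxVec P u ι) N hy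
  obtain ⟨s, hs, rfl⟩ := (Submonoid.mem_map).mp hx
  refine ⟨s, hs, g, hg, ?_⟩
  rw [← toAx_rename]
  exact e

theorem toAxVec_mem_extend {ι : Type*}
    {N : Submodule (MvPolynomial σ ℤ) (ι → MvPolynomial σ ℤ)} {g : ι → MvPolynomial σ ℤ}
    (hg : g ∈ N) : toAxVec P u ι g ∈ extend P u N :=
  Submodule.subset_span ⟨g, hg, rfl⟩

theorem mem_extendContract_iff {ι : Type*}
    {N : Submodule (MvPolynomial σ ℤ) (ι → MvPolynomial σ ℤ)} {f : ι → MvPolynomial σ ℤ} :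
    f ∈ extendContract P u N ↔ ∃ s ∉ pIdeal P u, rename Subtype.val s • f ∈ N := by
  constructor
  · intro hf
    obtain ⟨s, hs, g, hg, e⟩ := exists_smul_eq_of_mem_extend P u hf
    refine ⟨s, hs, ?_⟩
    rw [← toAx_rename, ← map_smulₛₗ] at e
    rwa [toAxVec_injective P u ι e]
  · rintro ⟨s, hs, h⟩
    have h' := toAxVec_mem_extend P u h
    rw [map_smulₛₗ, toAx_rename] at h'
    obtain ⟨v, hv⟩ := ((isUnit_algebraMap_A P u hs).map (C (σ := {i // i ∉ u})))
    rw [← hv] at h'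
    have := (extend P u N).smul_mem (↑v⁻¹ : Ax P u) h'
    rwa [smul_smul, Units.inv_mul, one_smul] at this

end ToAx

/-! ### Independent sets and algebraicity of ℤ[x]/P -/

section Independence

theorem mem_supported_iff_coeff {σ R : Type*} [CommSemiring R] {f : MvPolynomial σ R}
    {s : Set σ} : f ∈ supported R s ↔ ∀ δ, coeff δ f ≠ 0 → ∀ i, δ i ≠ 0 → i ∈ s := by
  rw [mem_supported]
  constructor
  · intro h δ hδ i hi
    exact h (by
      rw [Finset.mem_coe, mem_vars_iff_mem_support]
      exact ⟨δ, mem_support_iff.mpr hδ, Finsupp.mem_support_iff.mpr hi⟩)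
  · intro h i hi
    rw [Finset.mem_coe, mem_vars_iff_mem_support] at hi
    obtain ⟨δ, hδ, hi⟩ := hi
    exact h δ (mem_support_iff.mp hδ) i (Finsupp.mem_support_iff.mp hi)

variable {σ : Type*} (P : Ideal (MvPolynomial σ ℤ))

theorem map_intPart_le : (intPart P).map C ≤ P := Ideal.map_comap_le

theorem rename_mem_map_intPart_iff {u : Finset σ} {c : MvPolynomial {i // i ∈ u} ℤ} :
    rename Subtype.val c ∈ (intPart P).map (C : ℤ →+* MvPolynomial σ ℤ) ↔ c ∈ pIdeal P u := by
  rw [mem_map_C_iff, mem_map_C_iff]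
  constructor
  · intro h γ
    rw [← coeff_rename_mapDomain _ Subtype.val_injective]
    exact h _
  · intro h δ
    by_cases hδ : coeff δ (rename Subtype.val c) = 0
    · rw [hδ]
      exact Ideal.zero_mem _
    · obtain ⟨γ, rfl, -⟩ := coeff_rename_ne_zero _ _ _ hδ
      rw [coeff_rename_mapDomain _ Subtype.val_injective]
      exact h _

variable [P.IsPrime]

theorem ker_intCast_primeField :
    RingHom.ker (Int.castRingHom (PrimeField P)) = intPart P := by
  refine Eq.trans ?_ (Ideal.ker_algebraMap_residueField (intPart P))
  congr 1
  exact RingHom.ext_int _ _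

theorem ker_map_intCast :
    RingHom.ker (MvPolynomial.map (σ := σ) (Int.castRingHom (PrimeField P))) =
      (intPart P).map C := by
  rw [MvPolynomial.ker_map, ker_intCast_primeField]

theorem exists_int_mul_eq (a : PrimeField P) :
    ∃ t ∉ intPart P, ∃ b : ℤ, Int.castRingHom (PrimeField P) t * a = Int.castRingHom _ b := by
  obtain ⟨⟨x, y⟩, h⟩ := IsLocalization.surj (nonZeroDivisors (ℤ ⧸ intPart P)) a
  obtain ⟨b, hb⟩ := Ideal.Quotient.mk_surjective x
  obtain ⟨t, ht⟩ := Ideal.Quotient.mk_surjective y.1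
  have key : ∀ k : ℤ, Int.castRingHom (PrimeField P) k =
      algebraMap (ℤ ⧸ intPart P) (PrimeField P) (Ideal.Quotient.mk _ k) := by
    intro k
    simp
  refine ⟨t, ?_, b, ?_⟩
  · intro h0
    have : y.1 = 0 := by rw [← ht, Ideal.Quotient.eq_zero_iff_mem.mpr h0]
    exact nonZeroDivisors.ne_zero y.2 this
  · rw [key, key, ht, hb, mul_comm]
    exact h

theorem exists_map_mul_eq (y : MvPolynomial σ (PrimeField P)) :
    ∃ s ∈ (intPart P).primeCompl.map (C : ℤ →+* MvPolynomial σ ℤ), ∃ x,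
      MvPolynomial.map (Int.castRingHom (PrimeField P)) s * y =
        MvPolynomial.map (Int.castRingHom (PrimeField P)) x := by
  induction y using MvPolynomial.induction_on with
  | C a =>
    obtain ⟨t, ht, b, h⟩ := exists_int_mul_eq P a
    refine ⟨C t, ⟨t, ht, rfl⟩, C b, ?_⟩
    rw [map_C, map_C, ← C_mul, h]
  | add f g hf hg =>
    obtain ⟨s, hs, x, hx⟩ := hf
    obtain ⟨t, ht, y, hy⟩ := hg
    refine ⟨s * t, Submonoid.mul_mem _ hs ht, t * x + s * y, ?_⟩
    rw [map_add, map_mul, map_mul, map_mul, ← hx, ← hy]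
    ring
  | mul_X f i hf =>
    obtain ⟨s, hs, x, hx⟩ := hf
    refine ⟨s, hs, x * X i, ?_⟩
    rw [map_mul, ← hx, map_X, mul_assoc]

/-- Removes the prime field from the definition: independence becomes a condition on P ∩ ℤ[v]. The
kernel of ℤ[x] → 𝔽_p[x] is generated by P ∩ ℤ and is contained in P. -/
theorem isIndependent_iff (v : Finset σ) :
    IsIndependent P v ↔ ∀ f ∈ P, f ∈ supported ℤ (v : Set σ) → f ∈ (intPart P).map C := by
  constructor
  · intro h f hf hs
    rw [← ker_map_intCast, RingHom.mem_ker]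
    refine h _ (Ideal.mem_map_of_mem _ hf) ?_
    rw [mem_supported] at hs ⊢
    exact subset_trans (Finset.coe_subset.mpr (vars_map f _)) hs
  · intro h F hF hs
    obtain ⟨x, hx, f, hf, e⟩ := exists_smul_eq_of_mem_span_image
      (R' := MvPolynomial σ (PrimeField P)) (M' := MvPolynomial σ (PrimeField P))
      (M := MvPolynomial σ ℤ) _ (exists_map_mul_eq P)
      (MvPolynomial.map (Int.castRingHom (PrimeField P))).toSemilinearMap P hF
    obtain ⟨t, ht, rfl⟩ := Submonoid.mem_map.mp hx
    have e : C (Int.castRingHom (PrimeField P) t) * F =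
        MvPolynomial.map (Int.castRingHom (PrimeField P)) f := by
      rw [← map_C]
      exact e
    have ht0 : Int.castRingHom (PrimeField P) t ≠ 0 := by
      intro h0
      apply ht
      rwa [← RingHom.mem_ker, ker_intCast_primeField] at h0
    classical
    -- The numerator `f` of `F` need not lie in ℤ[v]; `f₀` keeps only its terms in the variables of
    -- `v`. The discarded coefficients vanish in 𝔽_p because `F` has no such terms, so `f₀` is still
    -- in P.
    let f₀ : MvPolynomial σ ℤ := ∑ δ ∈ f.support with ∀ i, δ i ≠ 0 → i ∈ v, monomial δ (coeff δ f)
    have hc : ∀ δ, coeff δ f₀ = if ∀ i, δ i ≠ 0 → i ∈ v then coeff δ f else 0 := by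
      intro δ
      simp only [f₀, coeff_sum, coeff_monomial]
      rw [Finset.sum_ite_eq']
      simp only [Finset.mem_filter, mem_support_iff]
      split_ifs with h1 h2 h2
      · rfl
      · exact absurd h1.2 h2
      · by_contra h3
        exact h1 ⟨fun h => h3 h.symm, h2⟩
      · rfl
    have hd : f - f₀ ∈ (intPart P).map C := by
      rw [mem_map_C_iff]
      intro δ
      rw [coeff_sub, hc]
      split_ifs with h1
      · simp
      · rw [sub_zero, ← ker_intCast_primeField, RingHom.mem_ker, ← coeff_map, ← e, coeff_C_mul]
        by_contra h2
        exact h1 (by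
          have := mem_supported_iff_coeff.mp hs δ (right_ne_zero_of_mul h2)
          simpa using this)
    have hf₀ : f₀ ∈ P := by
      have := P.sub_mem hf (map_intPart_le P hd)
      rwa [sub_sub_cancel] at this
    have hf₀' := h f₀ hf₀ (mem_supported_iff_coeff.mpr fun δ hδ i hi => by
      rw [hc] at hδ
      by_contra hn
      apply hδ
      rw [if_neg]
      intro h1
      exact hn (h1 i hi))
    have hfk : f ∈ (intPart P).map C := by
      have := Ideal.add_mem _ hd hf₀'
      rwa [sub_add_cancel] at this
    rw [← ker_map_intCast, RingHom.mem_ker, ← e, mul_eq_zero, C_eq_zero] at hfk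
    exact hfk.resolve_left ht0

variable {P}

theorem IsIndependent.rename_mem_iff {u : Finset σ} (hu : IsIndependent P u)
    {c : MvPolynomial {i // i ∈ u} ℤ} : rename Subtype.val c ∈ P ↔ c ∈ pIdeal P u := by
  rw [← rename_mem_map_intPart_iff P]
  refine ⟨fun h => (isIndependent_iff P u).mp hu _ h ?_, fun h => map_intPart_le P h⟩
  rw [supported_eq_range_rename]
  exact ⟨c, rfl⟩

variable [DecidableEq σ]

theorem eq_sum_rename_coeff_splitVars (u : Finset σ) (f : MvPolynomial σ ℤ) :
    f = ∑ β ∈ (splitVars u f).support, rename Subtype.val (coeff β (splitVars u f)) *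
      monomial (β.mapDomain Subtype.val) 1 := by
  apply splitVars_injective u
  rw [map_sum]
  conv_lhs => rw [← support_sum_monomial_coeff (splitVars u f)]
  refine Finset.sum_congr rfl fun β _ => ?_
  rw [map_mul, splitVars_rename_inner, splitVars_monomial_outer, C_mul_monomial, mul_one]

/-- A variable a ∉ u makes u ∪ {a} dependent, since it has more elements. The dependence is a
polynomial in P over ℤ[u] in the one variable a, and it does not vanish modulo ⟨p⟩, so the class of
a is algebraic. The variables generate the quotient. -/
theorem IsMaxIndependent.isAlgebraic {u : Finset σ} (hu : IsMaxIndependent P u) :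
    Algebra.IsAlgebraic ((Ideal.Quotient.mk P).comp
      (rename (R := ℤ) (Subtype.val : {i // i ∈ u} → σ)).toRingHom).range
      (MvPolynomial σ ℤ ⧸ P) := by
  set θ := (Ideal.Quotient.mk P).comp
      (rename (R := ℤ) (Subtype.val : {i // i ∈ u} → σ)).toRingHom with hθ
  have hX : ∀ a, IsAlgebraic θ.range (Ideal.Quotient.mk P (X a)) := by
    intro a
    by_cases ha : a ∈ u
    · exact isAlgebraic_algebraMap (⟨_, X ⟨a, ha⟩, by simp [hθ]; rfl⟩ : θ.range)
    have hdep : ¬ IsIndependent P (insert a u) := by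
      intro h
      have := hu.2 _ h
      rw [Finset.card_insert_of_notMem ha] at this
      omega
    rw [isIndependent_iff] at hdep
    push Not at hdep
    obtain ⟨f, hfP, hfs, hf⟩ := hdep
    rw [mem_supported_iff_coeff] at hfs
    -- An outer exponent of `f` is determined by its degree in `a`, so different terms do not merge
    -- in `Q` below.
    have hβ : ∀ β, coeff β (splitVars u f) ≠ 0 → β = Finsupp.single ⟨a, ha⟩ (β ⟨a, ha⟩) := by
      intro β hβ
      obtain ⟨γ, hγ⟩ := ne_zero_iff.mp hβ
      rw [coeff_coeff_splitVars] at hγ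
      ext ⟨j, hj⟩
      by_cases hja : j = a
      · subst hja
        simp
      · rw [Finsupp.single_eq_of_ne (by simpa using hja)]
        by_contra h
        have := hfs _ hγ j (by rwa [joinExp_apply, dif_neg hj])
        simp [hja, hj] at this
    let Q : Polynomial θ.range := ∑ β ∈ (splitVars u f).support,
      Polynomial.monomial (β ⟨a, ha⟩) (θ.rangeRestrict (coeff β (splitVars u f)))
    refine ⟨Q, ?_, ?_⟩
    -- Some coefficient in ℤ[u] lies outside ⟨p⟩, hence outside P by independence, and gives a
    -- nonzero coefficient of `Q`.
    · rw [mem_map_C_iff] at hf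
      push Not at hf
      obtain ⟨δ, hδ⟩ := hf
      rw [← joinExp_subtypeDomain u δ, ← coeff_coeff_splitVars] at hδ
      set β := δ.subtypeDomain (· ∉ u)
      have hmem : coeff β (splitVars u f) ∉ pIdeal P u := by
        rw [mem_map_C_iff]
        push Not
        exact ⟨_, hδ⟩
      intro h0
      have h1 : Q.coeff (β ⟨a, ha⟩) = θ.rangeRestrict (coeff β (splitVars u f)) := by
        rw [Polynomial.finsetSum_coeff, Finset.sum_eq_single β]
        · rw [Polynomial.coeff_monomial, if_pos rfl]
        · intro β' hβ' hne
          rw [Polynomial.coeff_monomial, if_neg]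
          intro h
          apply hne
          rw [hβ β' (mem_support_iff.mp hβ'), h, ← hβ β]
          intro h2
          exact hmem (by rw [h2]; exact Ideal.zero_mem _)
        · intro h2
          rw [notMem_support_iff.mp h2]
          simp
      rw [h0, Polynomial.coeff_zero] at h1
      have h2 : θ (coeff β (splitVars u f)) = 0 := (congrArg Subtype.val h1).symm
      exact hmem (hu.1.rename_mem_iff.mp (Ideal.Quotient.eq_zero_iff_mem.mp h2))
    · have h1 := congrArg (Ideal.Quotient.mk P) (eq_sum_rename_coeff_splitVars u f)
      rw [Ideal.Quotient.eq_zero_iff_mem.mpr hfP, map_sum] at h1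
      rw [map_sum, h1]
      refine Finset.sum_congr rfl fun β hb => ?_
      rw [Polynomial.aeval_monomial, map_mul]
      congr 1
      conv_rhs => rw [hβ β (mem_support_iff.mp hb)]
      rw [Finsupp.mapDomain_single, ← X_pow_eq_monomial, map_pow]
  constructor
  intro y
  obtain ⟨f, rfl⟩ := Ideal.Quotient.mk_surjective y
  rw [← Subalgebra.mem_algebraicClosure]
  induction f using MvPolynomial.induction_on with
  | C a =>
    rw [show Ideal.Quotient.mk P (C a) = ((a : ℤ) : MvPolynomial σ ℤ ⧸ P) by simp]
    exact intCast_mem _ a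
  | add f g hf hg => rw [map_add]; exact add_mem hf hg
  | mul_X f i hf => rw [map_mul]; exact mul_mem hf (hX i)

/-- In a domain, a nonzero element algebraic over a subring divides a nonzero element of that
subring. This is applied modulo P to an element of I ∖ P. -/
theorem IsMaxIndependent.exists_rename_mem {u : Finset σ} (hu : IsMaxIndependent P u)
    {I : Ideal (MvPolynomial σ ℤ)} (hPI : P ≤ I) (hI : ¬ I ≤ P) :
    ∃ c ∉ pIdeal P u, rename Subtype.val c ∈ I := by
  obtain ⟨x, hxI, hxP⟩ := SetLike.not_le_iff_exists.mp hI
  have hx0 : Ideal.Quotient.mk P x ≠ 0 := fun h => hxP (Ideal.Quotient.eq_zero_iff_mem.mp h)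
  obtain ⟨⟨_, c, rfl⟩, hc0, hc⟩ := (hu.isAlgebraic.isAlgebraic
    (Ideal.Quotient.mk P x)).exists_nonzero_dvd (mem_nonZeroDivisors_of_ne_zero hx0)
  refine ⟨c, fun h => hc0 ?_, ?_⟩
  · exact Subtype.ext (Ideal.Quotient.eq_zero_iff_mem.mpr (hu.1.rename_mem_iff.mpr h))
  · obtain ⟨y, hy⟩ := hc
    obtain ⟨y, rfl⟩ := Ideal.Quotient.mk_surjective y
    rw [← map_mul] at hy
    have h1 : rename Subtype.val c - x * y ∈ P := Ideal.Quotient.eq.mp hy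
    have := I.add_mem (hPI h1) (I.mul_mem_right y hxI)
    rwa [sub_add_cancel] at this

end Independence

/-! ### Annihilators, heights and primary submodules -/

section Primary

variable {R M : Type*} [CommRing R] [AddCommGroup M] [Module R M]

theorem mem_annihilator_quotient_iff {N : Submodule R M} {r : R} :
    r ∈ Module.annihilator R (M ⧸ N) ↔ ∀ x, r • x ∈ N := by
  rw [Module.mem_annihilator]
  constructor
  · intro h x
    rw [← Submodule.Quotient.mk_eq_zero, Submodule.Quotient.mk_smul, h]
  · intro h x
    obtain ⟨x, rfl⟩ := Submodule.Quotient.mk_surjective N x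
    rw [← Submodule.Quotient.mk_smul, Submodule.Quotient.mk_eq_zero]
    exact h x

theorem annihilator_quotient_mono {N N' : Submodule R M} (h : N ≤ N') :
    Module.annihilator R (M ⧸ N) ≤ Module.annihilator R (M ⧸ N') := fun _ hr =>
  mem_annihilator_quotient_iff.mpr fun x => h (mem_annihilator_quotient_iff.mp hr x)

/-- An ideal and its radical have the same minimal primes, so P has the height of Ann(M/Q), and
height is monotone. -/
theorem not_annihilator_le_of_height_lt {Q J : Submodule R M} {P : Ideal R}
    (hP : (Module.annihilator R (M ⧸ Q)).radical = P)
    (hheight : (Module.annihilator R (M ⧸ Q)).height < (Module.annihilator R (M ⧸ J)).height) :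
    ¬ Module.annihilator R (M ⧸ J) ≤ P := by
  intro h
  have h1 := Ideal.height_mono h
  have h2 : P.height = (Module.annihilator R (M ⧸ Q)).height := by
    rw [← hP, Ideal.height, Ideal.height]
    simp only [Ideal.radical_minimalPrimes]
  rw [h2] at h1
  exact absurd hheight (not_lt.mpr h1)

/-- The prime √Ann(M/(Q ∩ J)) contains Ann(M/Q)·Ann(M/J), hence one of the factors. It is contained
in P, so the factor is not Ann(M/J). -/
theorem le_radical_annihilator_inf {Q J : Submodule R M} {P : Ideal R}
    (hpseudo : IsPseudoPrimary (Q ⊓ J)) (hP : (Module.annihilator R (M ⧸ Q)).radical = P)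
    (hJ : ¬ Module.annihilator R (M ⧸ J) ≤ P) :
    P ≤ (Module.annihilator R (M ⧸ (Q ⊓ J))).radical := by
  have hle : (Module.annihilator R (M ⧸ (Q ⊓ J))).radical ≤ P := by
    rw [← hP]
    exact Ideal.radical_mono (annihilator_quotient_mono inf_le_left)
  have hmul : Module.annihilator R (M ⧸ Q) * Module.annihilator R (M ⧸ J) ≤
      (Module.annihilator R (M ⧸ (Q ⊓ J))).radical := by
    refine le_trans (Ideal.mul_le.mpr fun r hr s hs => ?_) Ideal.le_radical
    rw [mem_annihilator_quotient_iff] at hr hs ⊢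
    intro x
    refine ⟨?_, ?_⟩
    · rw [mul_smul]
      exact hr _
    · rw [mul_smul]
      exact J.smul_mem _ (hs x)
  have hprime : (Module.annihilator R (M ⧸ (Q ⊓ J))).radical.IsPrime := hpseudo
  rcases hprime.mul_le.mp hmul with h | h
  · rw [← hP]
    exact hprime.radical_le_iff.mpr h
  · exact absurd (h.trans hle) hJ

theorem mem_of_smul_mem_of_isPrimary {Q : Submodule R M} {P : Ideal R} (hQ : Q.IsPrimary)
    (hP : (Module.annihilator R (M ⧸ Q)).radical = P) {r : R} {x : M} (hr : r ∉ P)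
    (h : r • x ∈ Q) : x ∈ Q := by
  refine (hQ.2 h).resolve_right ?_
  rintro ⟨k, hk⟩
  apply hr
  rw [← hP]
  refine ⟨k, mem_annihilator_quotient_iff.mpr fun y => hk ?_⟩
  exact Submodule.smul_mem_pointwise_smul _ _ _ trivial

end Primary

/-- Denominators are outside P, so they cancel in Q. In the other direction, √Ann(M/J) contains P
strictly and therefore meets ℤ[u] ∖ ⟨p⟩. -/
theorem extendContract_inf_eq {σ ι : Type*} [DecidableEq σ]
    {Q J : Submodule (MvPolynomial σ ℤ) (ι → MvPolynomial σ ℤ)}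
    {P : Ideal (MvPolynomial σ ℤ)} [P.IsPrime] (hQ : Q.IsPrimary)
    (hP : (Module.annihilator (MvPolynomial σ ℤ) ((ι → MvPolynomial σ ℤ) ⧸ Q)).radical = P)
    (hJ : ¬ Module.annihilator (MvPolynomial σ ℤ) ((ι → MvPolynomial σ ℤ) ⧸ J) ≤ P)
    (hPN : P ≤ (Module.annihilator (MvPolynomial σ ℤ)
      ((ι → MvPolynomial σ ℤ) ⧸ (Q ⊓ J))).radical)
    {u : Finset σ} (hu : IsMaxIndependent P u) : extendContract P u (Q ⊓ J) = Q := by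
  ext f
  rw [mem_extendContract_iff]
  constructor
  · rintro ⟨s, hs, h⟩
    exact mem_of_smul_mem_of_isPrimary hQ hP (fun h' => hs (hu.1.rename_mem_iff.mp h')) h.1
  · intro hf
    obtain ⟨c, hc, k, hk⟩ := hu.exists_rename_mem
      (hPN.trans (Ideal.radical_mono (annihilator_quotient_mono inf_le_right)))
      (fun h => hJ (Ideal.le_radical.trans h))
    refine ⟨c ^ k, fun h => hc (Ideal.IsPrime.mem_of_pow_mem inferInstance k h), ?_⟩
    rw [map_pow]
    exact ⟨Q.smul_mem _ hf, mem_annihilator_quotient_iff.mp hk f⟩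

/-! ### Leading terms, well-foundedness and block orderings -/

section LeadingTerms

variable {σ ι : Type*}

theorem exists_isLeadingTerm [Finite ι] {R : Type*} [CommSemiring R]
    {r : Mon σ ι → Mon σ ι → Prop} (trans : ∀ s t w, r s t → r t w → r s w)
    (total : ∀ s t, r s t ∨ s = t ∨ r t s) {f : ι → MvPolynomial σ R} (hf : f ≠ 0) :
    ∃ s c, IsLeadingTerm r f s c := by
  have hmax : ∀ T : Finset (Mon σ ι), T.Nonempty → ∃ s ∈ T, ∀ t ∈ T, t = s ∨ r t s := by
    intro T hT
    induction hT using Finset.Nonempty.cons_induction with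
    | singleton a => exact ⟨a, by simp, by simp⟩
    | cons a T ha _ ih =>
      obtain ⟨s, hs, h⟩ := ih
      rcases total a s with has | rfl | hsa
      · refine ⟨s, by simp [hs], fun t ht => ?_⟩
        rcases Finset.mem_cons.mp ht with rfl | ht
        exacts [Or.inr has, h t ht]
      · exact absurd hs ha
      · refine ⟨a, by simp, fun t ht => ?_⟩
        rcases Finset.mem_cons.mp ht with rfl | ht
        · exact Or.inl rfl
        · rcases h t ht with rfl | h
          exacts [Or.inr hsa, Or.inr (trans _ _ _ h hsa)]
  have hfin : {t : Mon σ ι | coeff t.1 (f t.2) ≠ 0}.Finite := by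
    have : {t : Mon σ ι | coeff t.1 (f t.2) ≠ 0} =
        ⋃ i, (fun α => (α, i)) '' ((f i).support : Set (σ →₀ ℕ)) := by
      ext ⟨α, i⟩
      simp
    rw [this]
    exact Set.finite_iUnion fun i => ((f i).support.finite_toSet).image _
  have hne : hfin.toFinset.Nonempty := by
    obtain ⟨i, hi⟩ := Function.ne_iff.mp hf
    obtain ⟨α, hα⟩ := ne_zero_iff.mp hi
    exact ⟨(α, i), by simpa using hα⟩
  obtain ⟨s, hs, h⟩ := hmax _ hne
  simp only [Set.Finite.mem_toFinset, Set.mem_ofPred_eq] at hs h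
  exact ⟨s, _, hs, rfl, h⟩

theorem IsLeadingTerm.unique {R : Type*} [CommSemiring R]
    {r : Mon σ ι → Mon σ ι → Prop} (irrefl : ∀ s, ¬ r s s)
    (trans : ∀ s t w, r s t → r t w → r s w) {f : ι → MvPolynomial σ R} {s t : Mon σ ι} {c d : R}
    (h : IsLeadingTerm r f s c) (h' : IsLeadingTerm r f t d) : s = t ∧ c = d := by
  have hst : s = t := by
    rcases h.2.2 t (by rw [h'.2.1]; exact h'.1) with h1 | h1
    · exact h1.symm
    · rcases h'.2.2 s (by rw [h.2.1]; exact h.1) with h2 | h2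
      · exact h2
      · exact absurd (trans _ _ _ h1 h2) (irrefl _)
  subst hst
  exact ⟨rfl, h.2.1.symm.trans h'.2.1⟩

variable {mo : MonomialOrder σ} {r : Mon σ ι → Mon σ ι → Prop}

theorem IsModuleOrder.toSyn_lt (hr : IsModuleOrder mo r) {α β : σ →₀ ℕ} {i : ι}
    (h : r (α, i) (β, i)) : mo.toSyn α < mo.toSyn β := by
  by_contra hn
  rcases lt_or_eq_of_le (not_lt.mp hn) with h1 | h1
  · exact hr.irrefl _ (hr.trans _ _ _ h (hr.compat _ _ i h1))
  · rw [mo.toSyn.injective h1] at h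
    exact hr.irrefl _ h

/-- An infinite descending chain has infinitely many terms in one of the finitely many components,
where `r` is the monomial well-ordering `mo`. -/
theorem IsModuleOrder.wellFounded [Finite ι] (hr : IsModuleOrder mo r) : WellFounded r := by
  have : IsStrictOrder (Mon σ ι) r := { irrefl := hr.irrefl, trans := hr.trans }
  rw [RelEmbedding.wellFounded_iff_isEmpty]
  refine ⟨fun e => ?_⟩
  obtain ⟨i, hi⟩ := Finite.exists_infinite_fiber fun k => (e k).2
  have hinf : {k | (e k).2 = i}.Infinite := Set.infinite_coe_iff.mp hi
  obtain ⟨φ, hmono, hφ'⟩ := Filter.extraction_of_frequently_atTop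
    (Nat.frequently_atTop_iff_infinite.mpr hinf)
  have hφ : ∀ k, e (φ k) = ((e (φ k)).1, i) := fun k => Prod.ext rfl (hφ' k)
  refine (RelEmbedding.wellFounded_iff_isEmpty.mp
    (wellFounded_lt (α := mo.syn))).false (RelEmbedding.natGT (fun k => mo.toSyn (e (φ k)).1) ?_)
  intro k
  apply hr.toSyn_lt (i := i)
  rw [← hφ, ← hφ]
  exact e.map_rel_iff.mpr (hmono (Nat.lt_succ_self k))

variable {u : Finset σ}

theorem IsModuleOrder.inducedOrder_irrefl (hr : IsModuleOrder mo r) (s) :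
    ¬ inducedOrder u r s s := hr.irrefl _

theorem IsModuleOrder.inducedOrder_trans (hr : IsModuleOrder mo r) (s t w)
    (h : inducedOrder u r s t) (h' : inducedOrder u r t w) : inducedOrder u r s w :=
  hr.trans _ _ _ h h'

theorem IsModuleOrder.inducedOrder_total (hr : IsModuleOrder mo r) (s t) :
    inducedOrder u r s t ∨ s = t ∨ inducedOrder u r t s := by
  rcases hr.total (s.1.mapDomain Subtype.val, s.2) (t.1.mapDomain Subtype.val, t.2) with h | h | h
  · exact Or.inl h
  · obtain ⟨h1, h2⟩ := Prod.mk.inj h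
    exact Or.inr (Or.inl (Prod.ext (Finsupp.mapDomain_injective Subtype.val_injective h1) h2))
  · exact Or.inr (Or.inr h)

theorem IsModuleOrder.inducedOrder_shift (hr : IsModuleOrder mo r) {α β : {i // i ∉ u} →₀ ℕ}
    {i j : ι} (h : inducedOrder u r (α, i) (β, j)) (γ : {i // i ∉ u} →₀ ℕ) :
    inducedOrder u r (α + γ, i) (β + γ, j) := by
  unfold inducedOrder at h ⊢
  simp only [Finsupp.mapDomain_add]
  exact hr.shift _ _ _ _ _ h

theorem IsModuleOrder.inducedOrder_wellFounded [Finite ι] (hr : IsModuleOrder mo r) :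
    WellFounded (inducedOrder u r) :=
  InvImage.wf (fun s : Mon {i // i ∉ u} ι => ((s.1.mapDomain Subtype.val, s.2) : Mon σ ι))
    hr.wellFounded

variable [DecidableEq σ]

theorem dropVars_eq (u : Finset σ) (s : Mon σ ι) :
    dropVars u s = ((s.1.subtypeDomain (· ∉ u)).mapDomain Subtype.val, s.2) := by
  refine Prod.ext ?_ rfl
  ext i
  by_cases hi : i ∉ u
  · rw [mapDomain_val_apply (q := (· ∉ u)) _ hi]
    simp [dropVars, hi]
  · rw [mapDomain_val_apply_of_not (q := (· ∉ u)) _ hi]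
    simp only [dropVars]
    exact Finsupp.filter_apply_neg _ _ hi

theorem IsBlockOrder.rel (hb : IsBlockOrder u r) {s t : Mon σ ι}
    (h : inducedOrder u r (s.1.subtypeDomain (· ∉ u), s.2) (t.1.subtypeDomain (· ∉ u), t.2)) :
    r s t :=
  hb s t (by rw [dropVars_eq, dropVars_eq]; exact h)

theorem exists_coeff_ne_zero_of_coeff_toAx_ne_zero (P : Ideal (MvPolynomial σ ℤ)) [P.IsPrime]
    {f : MvPolynomial σ ℤ} {β : {i // i ∉ u} →₀ ℕ} (h : coeff β (toAx P u f) ≠ 0) :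
    ∃ γ, coeff (joinExp β γ) f ≠ 0 := by
  rw [coeff_toAx] at h
  obtain ⟨γ, hγ⟩ := ne_zero_iff.mp (ne_zero_of_map h)
  exact ⟨γ, by rwa [coeff_coeff_splitVars] at hγ⟩

theorem coeff_splitVars_ne_zero {f : MvPolynomial σ ℤ} {δ : σ →₀ ℕ} (h : coeff δ f ≠ 0) :
    coeff (δ.subtypeDomain (· ∉ u)) (splitVars u f) ≠ 0 := by
  intro h0
  apply h
  rw [← joinExp_subtypeDomain u δ, ← coeff_coeff_splitVars, h0, coeff_zero]

theorem coeff_toAx_ne_zero_iff (P : Ideal (MvPolynomial σ ℤ)) [P.IsPrime]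
    {f : MvPolynomial σ ℤ} {β : {i // i ∉ u} →₀ ℕ} :
    coeff β (toAx P u f) ≠ 0 ↔ coeff β (splitVars u f) ≠ 0 := by
  rw [coeff_toAx]
  exact map_ne_zero_iff _ (algebraMap_A_injective P u)

/-- With respect to a block ordering, the leading monomial over `A` is the part outside `u` of the
leading monomial over `ℤ`. -/
theorem IsLeadingTerm.toAxVec (P : Ideal (MvPolynomial σ ℤ)) [P.IsPrime]
    (hr : IsModuleOrder mo r) (hb : IsBlockOrder u r) {f : ι → MvPolynomial σ ℤ} {s : Mon σ ι}
    {c : ℤ} (h : IsLeadingTerm r f s c) :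
    IsLeadingTerm (inducedOrder u r) (toAxVec P u ι f) (s.1.subtypeDomain (· ∉ u), s.2)
      (algebraMap _ (A P u) (coeff (s.1.subtypeDomain (· ∉ u)) (splitVars u (f s.2)))) := by
  refine ⟨?_, coeff_toAx P u _ _, ?_⟩
  · rw [← coeff_toAx, coeff_toAx_ne_zero_iff]
    exact coeff_splitVars_ne_zero (by rw [h.2.1]; exact h.1)
  · rintro ⟨β, j⟩ hβ
    obtain ⟨γ, hγ⟩ := exists_coeff_ne_zero_of_coeff_toAx_ne_zero P hβ
    rcases hr.inducedOrder_total (u := u) (β, j) (s.1.subtypeDomain (· ∉ u), s.2) with h1 | h1 | h1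
    · exact Or.inr h1
    · exact Or.inl h1
    · exfalso
      have h2 : r s (joinExp β γ, j) := hb.rel (by simpa using h1)
      rcases h.2.2 (joinExp β γ, j) hγ with h3 | h3
      · rw [h3] at h2
        exact hr.irrefl _ h2
      · exact hr.irrefl _ (hr.trans _ _ _ h2 h3)

end LeadingTerms

/-! ### Divisibility by p in ℤ[u] -/

section Arithmetic

variable {σ : Type*} {P : Ideal (MvPolynomial σ ℤ)} {u : Finset σ} {p : ℕ}

theorem mem_pIdeal_iff_dvd (hp : intPart P = Ideal.span {(p : ℤ)})
    {c : MvPolynomial {i // i ∈ u} ℤ} : c ∈ pIdeal P u ↔ C (p : ℤ) ∣ c := by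
  rw [pIdeal, hp, Ideal.map_span, Set.image_singleton, Ideal.mem_span_singleton]

theorem eq_zero_or_prime_of_intPart_eq [P.IsPrime] (hp : intPart P = Ideal.span {(p : ℤ)}) :
    p = 0 ∨ Prime (p : ℤ) := by
  rcases eq_or_ne p 0 with h | h
  · exact Or.inl h
  · right
    have h1 : (intPart P).IsPrime := inferInstance
    rw [hp] at h1
    exact (Ideal.span_singleton_prime (by exact_mod_cast h)).mp h1

theorem exists_eq_pow_mul [P.IsPrime] (hp : intPart P = Ideal.span {(p : ℤ)})
    {c : MvPolynomial {i // i ∈ u} ℤ} (hc : c ≠ 0) :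
    ∃ (k : ℕ) (a : MvPolynomial {i // i ∈ u} ℤ), a ∉ pIdeal P u ∧ c = C (p : ℤ) ^ k * a := by
  rcases eq_zero_or_prime_of_intPart_eq hp with rfl | hpr
  -- For p = 0 the ideal ⟨p⟩ is zero, so `c` itself is outside it.
  · refine ⟨0, c, ?_, by simp⟩
    rw [mem_pIdeal_iff_dvd hp]
    simpa using hc
  · have hC : Prime (C (p : ℤ) : MvPolynomial {i // i ∈ u} ℤ) := (MvPolynomial.prime_C_iff _).mpr hpr
    obtain ⟨a, ha, hn⟩ := (FiniteMultiplicity.of_prime_left hC hc).exists_eq_pow_mul_and_not_dvd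
    exact ⟨_, a, by rwa [mem_pIdeal_iff_dvd hp], ha⟩

/-- A polynomial is congruent modulo `m` to one without nonzero coefficients divisible by `m`. -/
theorem exists_add_C_mul {τ : Type*} (m : ℤ) (a : MvPolynomial τ ℤ) :
    ∃ a₀ a₁ : MvPolynomial τ ℤ, a = a₀ + C m * a₁ ∧ ∀ γ, coeff γ a₀ ≠ 0 → ¬ m ∣ coeff γ a₀ := by
  classical
  let a₀ : MvPolynomial τ ℤ := ∑ δ ∈ a.support with ¬ m ∣ coeff δ a, monomial δ (coeff δ a)
  have hc : ∀ δ, coeff δ a₀ = if m ∣ coeff δ a then 0 else coeff δ a := by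
    intro δ
    simp only [a₀, coeff_sum, coeff_monomial]
    rw [Finset.sum_ite_eq']
    by_cases h : m ∣ coeff δ a
    · simp [h]
    · have : coeff δ a ≠ 0 := fun h0 => h (by rw [h0]; exact dvd_zero _)
      simp [h, this]
  obtain ⟨a₁, h₁⟩ : C m ∣ a - a₀ := by
    rw [C_dvd_iff_dvd_coeff]
    intro δ
    rw [coeff_sub, hc]
    split_ifs with h <;> simp [h]
  refine ⟨a₀, a₁, by rw [← h₁, add_sub_cancel], fun γ h => ?_⟩
  rw [hc] at h ⊢
  split_ifs at h ⊢ with h1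
  · exact absurd rfl h
  · exact h1

theorem not_dvd_pow_of_not_dvd (hp : p = 0 ∨ Prime (p : ℤ)) {e : ℤ} (he : ¬ (p : ℤ) ∣ e) (k : ℕ) :
    ¬ (p : ℤ) ∣ e ^ k := by
  rcases hp with rfl | hp
  · simp only [Nat.cast_zero, zero_dvd_iff] at he ⊢
    exact pow_ne_zero _ he
  · exact fun h => he (hp.dvd_of_dvd_pow h)

theorem pow_dvd_of_pow_dvd_mul [P.IsPrime] {q : ℕ} (hp : intPart P = Ideal.span {(p : ℤ)})
    (hq : q = if p = 0 then 1 else p) {s c : MvPolynomial {i // i ∈ u} ℤ} (hs : s ∉ pIdeal P u)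
    {k : ℕ} (h : (q : MvPolynomial {i // i ∈ u} ℤ) ^ k ∣ s * c) :
    (q : MvPolynomial {i // i ∈ u} ℤ) ^ k ∣ c := by
  rcases eq_zero_or_prime_of_intPart_eq hp with rfl | hpr
  · simp [hq]
  · have hp0 : p ≠ 0 := by
      rintro rfl
      exact hpr.ne_zero rfl
    rw [if_neg hp0] at hq
    subst hq
    have hCq : (q : MvPolynomial {i // i ∈ u} ℤ) = C (q : ℤ) := by simp
    rw [hCq] at h ⊢
    rw [mem_pIdeal_iff_dvd hp] at hs
    exact ((MvPolynomial.prime_C_iff _).mpr hpr).pow_dvd_of_dvd_mul_left k hs h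

/-- The lcm divides the product of the finite set, which avoids the prime ideal ⟨p⟩. -/
theorem IsLcm.notMem_pIdeal [P.IsPrime] {S : Set (MvPolynomial {i // i ∈ u} ℤ)} (hS : S.Finite)
    (hn : ∀ b ∈ S, b ∉ pIdeal P u) {h : MvPolynomial {i // i ∈ u} ℤ} (hh : IsLcm S h) :
    h ∉ pIdeal P u := by
  intro hmem
  obtain ⟨d, hd⟩ := hh.2 (∏ b ∈ hS.toFinset, b) fun b hb =>
    Finset.dvd_prod_of_mem _ (hS.mem_toFinset.mpr hb)
  have h1 : ∏ b ∈ hS.toFinset, b ∈ pIdeal P u := by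
    rw [hd]
    exact Ideal.mul_mem_right _ _ hmem
  obtain ⟨b, hb, hb'⟩ := (Ideal.IsPrime.prod_mem_iff (p := pIdeal P u)).mp h1
  exact hn b (hS.mem_toFinset.mp hb) hb'

end Arithmetic

/-! ### Strong Gröbner bases over A and the saturation -/

section GroebnerExtension

variable {σ ι : Type*} [DecidableEq σ] {P : Ideal (MvPolynomial σ ℤ)} [P.IsPrime] {u : Finset σ}
  {p : ℕ} {mo : MonomialOrder σ} {r : Mon σ ι → Mon σ ι → Prop}
  {N : Submodule (MvPolynomial σ ℤ) (ι → MvPolynomial σ ℤ)}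

/-- The leading coefficient `p ^ k * a` over `A`, where `p ∤ a`, of an element of `N` is up to a
unit the one of another element of `N` whose leading coefficient over `ℤ` is `p ^ k * d` with
`p ∤ d`. -/
theorem exists_mem_isLeadingTerm_of_isLeadingTerm_toAxVec [DecidableEq ι]
    (hr : IsModuleOrder mo r) (hb : IsBlockOrder u r)
    (hp : intPart P = Ideal.span {(p : ℤ)})
    (hPN : P ≤ (Module.annihilator (MvPolynomial σ ℤ) ((ι → MvPolynomial σ ℤ) ⧸ N)).radical)
    {f : ι → MvPolynomial σ ℤ} (hf : f ∈ N) {β : {i // i ∉ u} →₀ ℕ} {i : ι} {k : ℕ}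
    {a : MvPolynomial {i // i ∈ u} ℤ} (ha : a ∉ pIdeal P u)
    (hc0 : C (p : ℤ) ^ k * a ≠ 0) (hc : coeff β (splitVars u (f i)) = C (p : ℤ) ^ k * a)
    (hlt : ∀ t : Mon {i // i ∉ u} ι, coeff t.1 (splitVars u (f t.2)) ≠ 0 →
      t = (β, i) ∨ inducedOrder u r t (β, i)) :
    ∃ f' ∈ N, ∃ γ, ∃ d : ℤ, IsLeadingTerm r f' (joinExp β γ, i) ((p : ℤ) ^ k * d) ∧
      ¬ (p : ℤ) ∣ d := by
  have hpc := eq_zero_or_prime_of_intPart_eq hp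
  have hpP : (C (p : ℤ) : MvPolynomial σ ℤ) ∈ P := by
    have : (p : ℤ) ∈ intPart P := by
      rw [hp]
      exact Ideal.mem_span_singleton_self _
    exact this
  -- p ∈ P, so p^K kills M/N: every multiple of p^K may be added to `f` without leaving N.
  obtain ⟨K, hK⟩ := hPN hpP
  rw [mem_annihilator_quotient_iff] at hK
  obtain ⟨a₀, a₁, haa, ha₀⟩ := exists_add_C_mul (p : ℤ) a
  have ha₀0 : a₀ ≠ 0 := by
    rintro rfl
    apply ha
    rw [mem_pIdeal_iff_dvd hp, haa, zero_add]
    exact dvd_mul_right _ _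
  -- Here a = a₀ − p(−a₁). Multiplying `f` by `t` turns the leading coefficient into p^k (a₀^K − (−p
  -- a₁)^K); the second term is a multiple of p^K and is cancelled by p^K `y`.
  obtain ⟨t, ht⟩ : a ∣ a₀ ^ K - (C (p : ℤ) * -a₁) ^ K := by
    have := sub_dvd_pow_sub_pow a₀ (C (p : ℤ) * -a₁) K
    rwa [mul_neg, sub_neg_eq_add, ← haa, ← mul_neg] at this
  set w : MvPolynomial {i // i ∈ u} ℤ := C (p : ℤ) ^ k * (-a₁) ^ K with hw
  set y : ι → MvPolynomial σ ℤ :=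
    Pi.single i (rename Subtype.val w * monomial (β.mapDomain Subtype.val) 1) with hy
  set f' : ι → MvPolynomial σ ℤ :=
    (rename Subtype.val t : MvPolynomial σ ℤ) • f + (C (p : ℤ) : MvPolynomial σ ℤ) ^ K • y with hf'
  have hsplit : ∀ s : Mon {i // i ∉ u} ι, coeff s.1 (splitVars u (f' s.2)) =
      t * coeff s.1 (splitVars u (f s.2)) + if s = (β, i) then C (p : ℤ) ^ K * w else 0 := by
    rintro ⟨β', j⟩
    have hCp : (C (p : ℤ) : MvPolynomial σ ℤ) ^ K =
        rename Subtype.val ((C (p : ℤ) : MvPolynomial {i // i ∈ u} ℤ) ^ K) := by simp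
    simp only [hf', Pi.add_apply, Pi.smul_apply, smul_eq_mul, hCp, map_add, map_mul (splitVars u),
      splitVars_rename_inner, coeff_add, coeff_C_mul]
    congr 1
    by_cases hj : j = i
    · subst hj
      simp only [hy, Pi.single_eq_same, map_mul (splitVars u), splitVars_rename_inner,
        splitVars_monomial_outer, coeff_C_mul, coeff_monomial, Prod.mk.injEq, and_true]
      by_cases hβ : β = β'
      · simp [hβ]
      · simp [hβ, Ne.symm hβ]
    · simp [hy, hj]
  have hlc : coeff β (splitVars u (f' i)) = C (p : ℤ) ^ k * a₀ ^ K := by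
    have h1 := hsplit (β, i)
    simp only [if_true] at h1
    rw [h1, hc, hw]
    have h2 : t * (C (p : ℤ) ^ k * a) + C (p : ℤ) ^ K * (C (p : ℤ) ^ k * (-a₁) ^ K) =
        C (p : ℤ) ^ k * (a * t + (C (p : ℤ) * -a₁) ^ K) := by ring
    rw [h2, ← ht, sub_add_cancel]
  -- The leading integer of a₀^K for `mo` is a power of a coefficient of a₀, hence not divisible by
  -- p.
  set b : MvPolynomial σ ℤ := rename Subtype.val a₀ with hb'
  have hb0 : b ≠ 0 := by
    rw [hb', Ne, map_eq_zero_iff _ (rename_injective _ Subtype.val_injective)]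
    exact ha₀0
  have hbd : ¬ (p : ℤ) ∣ mo.leadingCoeff b := by
    have h1 : coeff (mo.degree b) b ≠ 0 := mo.leadingCoeff_ne_zero_iff.mpr hb0
    obtain ⟨γ, hγ, h2⟩ := coeff_rename_ne_zero _ _ _ h1
    rw [MonomialOrder.leadingCoeff, ← hγ, hb', coeff_rename_mapDomain _ Subtype.val_injective]
    exact ha₀ γ h2
  have hbK : coeff (mo.degree (b ^ K)) (b ^ K) ≠ 0 :=
    mo.leadingCoeff_ne_zero_iff.mpr (pow_ne_zero _ hb0)
  have hrK : rename Subtype.val (a₀ ^ K) = b ^ K := map_pow _ _ _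
  obtain ⟨γ, hγ, hγ0⟩ := coeff_rename_ne_zero (Subtype.val : {i // i ∈ u} → σ) (a₀ ^ K) _
    (by rw [hrK]; exact hbK)
  have hγc : coeff γ (a₀ ^ K) = mo.leadingCoeff b ^ K := by
    rw [← MonomialOrder.leadingCoeff_pow, MonomialOrder.leadingCoeff, ← hγ, ← hrK,
      coeff_rename_mapDomain _ Subtype.val_injective]
  have hpk : (p : ℤ) ^ k ≠ 0 := by
    intro h0
    apply hc0
    rw [← map_pow, h0, C_0, zero_mul]
  refine ⟨f', N.add_mem (N.smul_mem _ hf) (hK y), γ, mo.leadingCoeff b ^ K, ⟨?_, ?_, ?_⟩,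
    not_dvd_pow_of_not_dvd hpc hbd K⟩
  · rw [← hγc]
    exact mul_ne_zero hpk hγ0
  · simp only
    rw [← coeff_coeff_splitVars, hlc, ← map_pow, coeff_C_mul, hγc]
  · rintro ⟨δ, j⟩ hδ
    have hδ' : coeff (δ.subtypeDomain (· ∉ u)) (splitVars u (f' j)) ≠ 0 :=
      coeff_splitVars_ne_zero hδ
    have hcases : (δ.subtypeDomain (· ∉ u), j) = (β, i) ∨
        inducedOrder u r (δ.subtypeDomain (· ∉ u), j) (β, i) := by
      by_cases hs : (δ.subtypeDomain (· ∉ u), j) = (β, i)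
      · exact Or.inl hs
      · have h1 := hsplit (δ.subtypeDomain (· ∉ u), j)
        rw [if_neg hs, add_zero] at h1
        simp only at h1
        rw [h1] at hδ'
        exact hlt (_, j) (right_ne_zero_of_mul hδ')
    rcases hcases with h1 | h1
    -- Within the block of `β` and `i`, the u-parts of the monomials come from a₀^K and are compared
    -- by `mo`.
    · obtain ⟨h5, rfl⟩ := Prod.mk.inj h1
      have hδe : δ = joinExp β (δ.subtypeDomain (· ∈ u)) := by
        rw [← h5, joinExp_subtypeDomain]
      simp only at hδ
      rw [hδe, ← coeff_coeff_splitVars, hlc, ← map_pow, coeff_C_mul] at hδ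
      have h2 : coeff ((δ.subtypeDomain (· ∈ u)).mapDomain Subtype.val) (b ^ K) ≠ 0 := by
        rw [← hrK, coeff_rename_mapDomain _ Subtype.val_injective]
        exact right_ne_zero_of_mul hδ
      have h3 := mo.le_degree (mem_support_iff.mpr h2)
      rw [← hγ] at h3
      rcases lt_or_eq_of_le h3 with h4 | h4
      · right
        rw [hδe]
        apply hr.compat
        rw [joinExp, joinExp, map_add, map_add]
        exact add_lt_add_right h4 _
      · left
        rw [hδe]
        rw [Finsupp.mapDomain_injective Subtype.val_injective (mo.toSyn.injective h4)]
    · exact Or.inr (hb.rel (by simpa using h1))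

theorem isStrongGroebnerBasis_extend [Finite ι] {G : Set (ι → MvPolynomial σ ℤ)}
    (hr : IsModuleOrder mo r) (hb : IsBlockOrder u r)
    (hp : intPart P = Ideal.span {(p : ℤ)})
    (hPN : P ≤ (Module.annihilator (MvPolynomial σ ℤ) ((ι → MvPolynomial σ ℤ) ⧸ N)).radical)
    (hG : IsStrongGroebnerBasis r N G) :
    IsStrongGroebnerBasis (inducedOrder u r) (extend P u N) (toAxVec P u ι '' G) := by
  classical
  refine ⟨hG.1.image _, ?_, ?_⟩
  · rintro _ ⟨g, hg, rfl⟩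
    exact toAxVec_mem_extend P u (hG.2.1 hg)
  intro F hF hF0
  obtain ⟨⟨β, i⟩, c, hc0, hc, hlt⟩ :=
    exists_isLeadingTerm hr.inducedOrder_trans (hr.inducedOrder_total (u := u)) hF0
  simp only at hc
  obtain ⟨s, hs, f, hf, hsf⟩ := exists_smul_eq_of_mem_extend P u hF
  have hsu := isUnit_algebraMap_A P u hs
  have hcoeff : ∀ (β' : {i // i ∉ u} →₀ ℕ) (j : ι),
      algebraMap _ (A P u) (coeff β' (splitVars u (f j))) =
        algebraMap _ (A P u) s * coeff β' (F j) := by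
    intro β' j
    rw [← coeff_toAx, ← toAxVec_apply, ← hsf, Pi.smul_apply, smul_eq_mul, coeff_C_mul]
  have hcβ := hcoeff β i
  rw [hc] at hcβ
  have hne : coeff β (splitVars u (f i)) ≠ 0 := by
    intro h0
    rw [h0, map_zero] at hcβ
    exact hc0 ((hsu.mul_right_eq_zero).mp hcβ.symm)
  obtain ⟨k, a, ha, hka⟩ := exists_eq_pow_mul hp hne
  obtain ⟨f', hf', γ, d, hd, hpd⟩ := exists_mem_isLeadingTerm_of_isLeadingTerm_toAxVec hr hb hp
    hPN hf ha (hka ▸ hne) hka (by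
      rintro ⟨β', j⟩ h
      apply hlt
      simp only
      intro h0
      have h1 := hcoeff β' j
      rw [h0, mul_zero] at h1
      exact h (algebraMap_A_injective P u (h1.trans (map_zero _).symm)))
  have hf'0 : f' ≠ 0 := by
    rintro rfl
    apply hd.1
    rw [← hd.2.1]
    simp
  obtain ⟨g, hg, s', e, t', e', hLg, hLf', h1, h2, h3⟩ := hG.2.2 f' hf' hf'0
  obtain ⟨rfl, rfl⟩ := hd.unique hr.irrefl hr.trans hLf'
  have hLg' := hLg.toAxVec P hr hb
  refine ⟨_, ⟨g, hg, rfl⟩, _, _, (β, i), c, hLg', ⟨hc0, hc, hlt⟩, h1, ?_, ?_⟩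
  · have hcg : coeff (s'.1.subtypeDomain (· ∉ u)) (splitVars u (g s'.2)) ≠ 0 :=
      ne_zero_of_map hLg'.1
    obtain ⟨l, a', ha', hla'⟩ := exists_eq_pow_mul hp hcg
    -- p^l divides the integer leading coefficient `e` of `g`, and e ∣ p^k d with p ∤ d.
    have hlk : l ≤ k := by
      by_contra hkl
      have h4 : (p : ℤ) ^ (k + 1) ∣ e := by
        rw [← hLg.2.1, ← joinExp_subtypeDomain u s'.1, ← coeff_coeff_splitVars, hla', ← map_pow,
          coeff_C_mul]
        exact Dvd.dvd.mul_right (pow_dvd_pow _ (by omega)) _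
      have h5 := h4.trans h2
      rw [pow_succ] at h5
      exact hpd ((mul_dvd_mul_iff_left (left_ne_zero_of_mul hd.1)).mp h5)
    -- The factors `a'` and `s` are units of A, so only p^l ∣ p^k a remains to be checked.
    rw [hla', map_mul, (isUnit_algebraMap_A P u ha').mul_right_dvd]
    rw [← (hsu.dvd_mul_left (b := c)), ← hcβ, hka]
    exact map_dvd _ (Dvd.dvd.mul_right (pow_dvd_pow _ hlk) _)
  · intro j
    simp only [Finsupp.subtypeDomain_apply]
    have h4 := h3 j.1
    simp only [joinExp_apply, dif_neg j.2] at h4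
    exact h4

theorem exists_pow_smul_mem [Finite ι] {q : ℕ} {G : Set (ι → MvPolynomial σ ℤ)}
    (hr : IsModuleOrder mo r) (hp : intPart P = Ideal.span {(p : ℤ)})
    (hq : q = if p = 0 then 1 else p) (hGN : G ⊆ N)
    (hG : IsStrongGroebnerBasis (inducedOrder u r) (extend P u N) (toAxVec P u ι '' G))
    {ν : (ι → MvPolynomial σ ℤ) → ℕ} {a : (ι → MvPolynomial σ ℤ) → MvPolynomial {i // i ∈ u} ℤ}
    {h : MvPolynomial {i // i ∈ u} ℤ}
    (ha : ∀ g ∈ G, g ≠ 0 → a g ∉ pIdeal P u ∧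
      ∃ s, IsLeadingTerm (inducedOrder u r) (toAxVec P u ι g) s
        (algebraMap (MvPolynomial {i // i ∈ u} ℤ) (A P u) ((q : MvPolynomial _ ℤ) ^ ν g * a g)))
    (hh : ∀ g ∈ G, g ≠ 0 → a g ∣ h) (s : Mon {i // i ∉ u} ι) :
    ∀ f ∈ extendContract P u N, ∀ c, IsLeadingTerm (inducedOrder u r) (toAxVec P u ι f) s c →
      ∃ k : ℕ, rename Subtype.val h ^ k • f ∈ N := by
  have hirr := hr.inducedOrder_irrefl (u := u)
  have htr := hr.inducedOrder_trans (u := u)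
  induction s using hr.inducedOrder_wellFounded.induction with
  | _ s ih =>
  intro f hf c hLf
  have hf0 : toAxVec P u ι f ≠ 0 := by
    intro h0
    apply hLf.1
    rw [← hLf.2.1, h0]
    simp
  obtain ⟨_, ⟨g, hg, rfl⟩, ⟨β, i⟩, e, t, d, hLg, hLf', h1, h2, h3⟩ := hG.2.2 _ hf hf0
  obtain ⟨rfl, rfl⟩ := hLf.unique hirr htr hLf'
  obtain ⟨β', i'⟩ := s
  simp only at h1 h3
  subst h1
  have hg0 : g ≠ 0 := by
    rintro rfl
    apply hLg.1
    rw [← hLg.2.1, map_zero]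
    simp
  obtain ⟨hag, s', hLg'⟩ := ha g hg hg0
  obtain ⟨rfl, rfl⟩ := hLg'.unique hirr htr hLg
  set cf := coeff β' (splitVars u (f i)) with hcf
  have hcf' : algebraMap _ (A P u) cf = c := by
    rw [← hLf.2.1, hcf]
    exact (coeff_toAx P u _ _).symm
  -- Divisibility in A descends to ℤ[u] for the factor q^ν, since a denominator outside ⟨p⟩ cannot
  -- supply powers of p.
  have hqd : (q : MvPolynomial {i // i ∈ u} ℤ) ^ ν g ∣ cf := by
    rw [← hcf'] at h2
    obtain ⟨z, hz⟩ := h2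
    obtain ⟨⟨y, m⟩, hy⟩ := IsLocalization.surj (pIdeal P u).primeCompl z
    refine pow_dvd_of_pow_dvd_mul hp hq m.2 ⟨a g * y, algebraMap_A_injective P u ?_⟩
    rw [map_mul, hz, map_mul _ _ (a g * y), map_mul _ (a g) y, ← hy, map_mul]
    ring
  obtain ⟨b, hb⟩ := hqd
  obtain ⟨k, hk⟩ := hh g hg hg0
  -- With cf = q^ν b and h = a_g k, one has h cf = (k b)(q^ν a_g), so the leading terms over A
  -- cancel although everything stays over ℤ[x].
  set f' : ι → MvPolynomial σ ℤ := rename Subtype.val h • f -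
    (rename Subtype.val (k * b) * monomial ((β' - β).mapDomain Subtype.val) 1) • g with hf'
  have hgN : (rename Subtype.val (k * b) * monomial ((β' - β).mapDomain Subtype.val) 1 :
      MvPolynomial σ ℤ) • g ∈ N := N.smul_mem _ (hGN hg)
  have hf'mem : f' ∈ extendContract P u N :=
    Submodule.sub_mem _ (Submodule.smul_mem _ _ hf) (toAxVec_mem_extend P u hgN)
  obtain ⟨l, hl⟩ : ∃ l : ℕ, rename Subtype.val h ^ l • f' ∈ N := by
    by_cases hf'0 : toAxVec P u ι f' = 0
    · refine ⟨0, ?_⟩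
      rw [toAxVec_injective P u ι (hf'0.trans (map_zero _).symm), smul_zero]
      exact N.zero_mem
    obtain ⟨s, c', hLs⟩ := exists_isLeadingTerm htr (hr.inducedOrder_total (u := u)) hf'0
    refine ih s ?_ f' hf'mem c' hLs
    have hcoeff : ∀ (δ : {i // i ∉ u} →₀ ℕ) (j : ι), coeff δ (toAxVec P u ι f' j) =
        algebraMap _ (A P u) h * coeff δ (toAxVec P u ι f j) - algebraMap _ (A P u) (k * b) *
          if β' - β ≤ δ then coeff (δ - (β' - β)) (toAxVec P u ι g j) else 0 := by
      intro δ j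
      rw [hf', map_sub, map_smulₛₗ, map_smulₛₗ, map_mul, toAx_rename, toAx_rename, toAx_monomial,
        Pi.sub_apply, Pi.smul_apply, Pi.smul_apply, smul_eq_mul, smul_eq_mul, coeff_sub,
        coeff_C_mul, mul_assoc, coeff_C_mul, coeff_monomial_mul', one_mul]
    have hsne : coeff s.1 (toAxVec P u ι f' s.2) ≠ 0 := by
      rw [hLs.2.1]
      exact hLs.1
    have hs : s ≠ (β', i) := by
      rintro rfl
      apply hsne
      have hg1 : coeff β (toAxVec P u ι g i) = _ := hLg.2.1
      have hf1 : coeff β' (toAxVec P u ι f i) = _ := hLf.2.1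
      simp only
      rw [hcoeff, if_pos tsub_le_self, tsub_tsub_cancel_of_le h3, hg1, hf1, ← hcf', hb, hk]
      simp only [map_mul]
      ring
    rw [hcoeff] at hsne
    -- A monomial of `f'` comes from `f` or from the shifted `g`. Both have leading monomial (β',
    -- i), which has cancelled, so the new leading monomial is smaller.
    by_cases hfs : coeff s.1 (toAxVec P u ι f s.2) = 0
    · rw [hfs, mul_zero, zero_sub, neg_ne_zero] at hsne
      have h4 := right_ne_zero_of_mul hsne
      split_ifs at h4 with hle
      · rcases hLg.2.2 (s.1 - (β' - β), s.2) h4 with h5 | h5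
        · exfalso
          apply hs
          obtain ⟨h6, h7⟩ := Prod.mk.inj h5
          refine Prod.ext ?_ h7
          rw [← tsub_add_cancel_of_le hle, h6, add_tsub_cancel_of_le h3]
        · have h6 := hr.inducedOrder_shift h5 (β' - β)
          rwa [tsub_add_cancel_of_le hle, add_tsub_cancel_of_le h3] at h6
      · exact absurd rfl h4
    · exact (hLf.2.2 s hfs).resolve_left hs
  refine ⟨l + 1, ?_⟩
  have h4 : rename Subtype.val h ^ (l + 1) • f = rename Subtype.val h ^ l • f' +
      (rename Subtype.val h : MvPolynomial σ ℤ) ^ l • ((rename Subtype.val (k * b) *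
        monomial ((β' - β).mapDomain Subtype.val) 1 : MvPolynomial σ ℤ) • g) := by
    rw [← smul_add, hf', sub_add_cancel, smul_smul, pow_succ]
  rw [h4]
  exact N.add_mem hl (N.smul_mem _ hgN)

theorem extendContract_eq_saturation [Finite ι] {q : ℕ} {G : Set (ι → MvPolynomial σ ℤ)}
    (hr : IsModuleOrder mo r) (hp : intPart P = Ideal.span {(p : ℤ)})
    (hq : q = if p = 0 then 1 else p) (hGN : G ⊆ N) (hGfin : G.Finite)
    (hG : IsStrongGroebnerBasis (inducedOrder u r) (extend P u N) (toAxVec P u ι '' G))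
    {ν : (ι → MvPolynomial σ ℤ) → ℕ} {a : (ι → MvPolynomial σ ℤ) → MvPolynomial {i // i ∈ u} ℤ}
    {h : MvPolynomial {i // i ∈ u} ℤ}
    (ha : ∀ g ∈ G, g ≠ 0 → a g ∉ pIdeal P u ∧
      ∃ s, IsLeadingTerm (inducedOrder u r) (toAxVec P u ι g) s
        (algebraMap (MvPolynomial {i // i ∈ u} ℤ) (A P u) ((q : MvPolynomial _ ℤ) ^ ν g * a g)))
    (hh : IsLcm {b | ∃ g ∈ G, g ≠ 0 ∧ a g = b} h) :
    extendContract P u N = saturation N (rename Subtype.val h) := by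
  apply le_antisymm
  · intro f hf
    by_cases hf0 : toAxVec P u ι f = 0
    · rw [toAxVec_injective P u ι (hf0.trans (map_zero _).symm)]
      exact Submodule.zero_mem _
    obtain ⟨s, c, hs⟩ := exists_isLeadingTerm hr.inducedOrder_trans
      (hr.inducedOrder_total (u := u)) hf0
    exact exists_pow_smul_mem hr hp hq hGN hG ha (fun g hg hg0 => hh.1 _ ⟨g, hg, hg0, rfl⟩) s f hf
      c hs
  · rintro f ⟨k, hk⟩
    rw [mem_extendContract_iff]
    have hn : h ∉ pIdeal P u := by
      refine IsLcm.notMem_pIdeal (S := {b | ∃ g ∈ G, g ≠ 0 ∧ a g = b}) ?_ ?_ hh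
      · refine (hGfin.image a).subset ?_
        rintro _ ⟨g, hg, -, rfl⟩
        exact ⟨g, hg, rfl⟩
      · rintro _ ⟨g, hg, hg0, rfl⟩
        exact (ha g hg hg0).1
    refine ⟨h ^ k, fun h' => hn (Ideal.IsPrime.mem_of_pow_mem inferInstance k h'), ?_⟩
    rwa [map_pow]

end GroebnerExtension

end Extraction

theorem lemma3p4 {n m : ℕ}
    (N Q J : Submodule (MvPolynomial (Fin n) ℤ) (Fin m → MvPolynomial (Fin n) ℤ))
    (P : Ideal (MvPolynomial (Fin n) ℤ)) [P.IsPrime]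
    (hN : N = Q ⊓ J) (hpseudo : IsPseudoPrimary N)
    (hQ : Q.IsPrimary)
    (hP : (Module.annihilator (MvPolynomial (Fin n) ℤ)
      ((Fin m → MvPolynomial (Fin n) ℤ) ⧸ Q)).radical = P)
    (hheight : (Module.annihilator (MvPolynomial (Fin n) ℤ)
        ((Fin m → MvPolynomial (Fin n) ℤ) ⧸ Q)).height <
      (Module.annihilator (MvPolynomial (Fin n) ℤ)
        ((Fin m → MvPolynomial (Fin n) ℤ) ⧸ J)).height)
    (u : Finset (Fin n)) (hu : IsMaxIndependent P u)
    (p q : ℕ) (hp : intPart P = Ideal.span {(p : ℤ)}) (hq : q = if p = 0 then 1 else p) :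
    extendContract P u N = Q ∧
    (∀ (mo : MonomialOrder (Fin n)) (r : Mon (Fin n) (Fin m) → Mon (Fin n) (Fin m) → Prop)
      (G : Set (Fin m → MvPolynomial (Fin n) ℤ)),
      IsModuleOrder mo r → IsBlockOrder u r → IsStrongGroebnerBasis r N G →
      IsStrongGroebnerBasis (inducedOrder u r) (extend P u N) (toAxVec P u (Fin m) '' G)) ∧
    (∀ (mo : MonomialOrder (Fin n)) (r : Mon (Fin n) (Fin m) → Mon (Fin n) (Fin m) → Prop)
      (G : Set (Fin m → MvPolynomial (Fin n) ℤ)),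
      IsModuleOrder mo r → IsBlockOrder u r → IsStrongGroebnerBasis r N G →
      ∀ (ν : (Fin m → MvPolynomial (Fin n) ℤ) → ℕ)
        (a : (Fin m → MvPolynomial (Fin n) ℤ) → MvPolynomial {i // i ∈ u} ℤ)
        (h : MvPolynomial {i // i ∈ u} ℤ),
        (∀ g ∈ G, g ≠ 0 → a g ∉ pIdeal P u ∧
          ∃ s, IsLeadingTerm (inducedOrder u r) (toAxVec P u (Fin m) g) s
            (algebraMap (MvPolynomial {i // i ∈ u} ℤ) (A P u) ((q : MvPolynomial _ ℤ) ^ ν g * a g))) →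
        IsLcm {b | ∃ g ∈ G, g ≠ 0 ∧ a g = b} h →
        extendContract P u N = saturation N (rename Subtype.val h)) := by
  subst hN
  have hJ := not_annihilator_le_of_height_lt hP hheight
  have hPN := le_radical_annihilator_inf hpseudo hP hJ
  refine ⟨extendContract_inf_eq hQ hP hJ hPN hu, ?_, ?_⟩
  · intro mo r G hr hb hG
    exact isStrongGroebnerBasis_extend hr hb hp hPN hG
  · intro mo r G hr hb hG ν a h ha hh
    exact extendContract_eq_saturation hr hp hq hG.2.1 hG.1
      (isStrongGroebnerBasis_extend hr hb hp hPN hG) ha hh
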